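/- \textbf{Setting.} A \emph{state} is a mapping from variable names to values. An \emph{Aczel trace} consists of an initial state followed by finitely or infinitely many transitions, each labelled as a program ($\pi$) or an environment ($\epsilon$) transition and leading to a state; a finite trace is terminated, aborted or incomplete. A \emph{command} is a set of traces that contains every incomplete trace without transitions, every incomplete finite prefix of each of its traces, and every extension of each of its aborted traces. Commands are ordered by inclusion and form a complete lattice; $c \succeq d$ ("$c$ is refined by $d$") means that every trace of $d$ is a trace of $c$; choice $\vee$ is the join. The greatest command $\lightning$ (abort) has all traces. For a set of states $p$ and a relation $r$ between states: the test $\lceil p\rceil$ terminates at once if the initial state is in $p$ and is infeasible otherwise; $\pi(r)$ (resp. $\epsilon(r)$) makes a single program (resp. environment) transition satisfying $r$ and terminates, and is infeasible if there is none. A trace of $c\,;d$ is a trace of $c$ that has not terminated, or an extension of an aborted trace of $c$, or a terminated trace of $c$ continued by a trace of $d$. The weak conjunction $c \Cap d$ has the common traces of $c$ and $d$, together with every extension of a finite trace at whose end one of $c,d$ aborts while the other has the same transitions as an incomplete trace. Write $\tau = \lceil \Sigma\rceil$ with $\Sigma$ the set of all states, $\{p\} = \tau \vee \lceil \overline p\rceil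 ; \lightning$, and $c^{\omega}$ for the greatest fixed point of $y \mapsto \tau \vee c\,;y$. With $\mathsf{univ}$ the universal relation, \[ \mathbf{guar}\,r = (\pi(r)\vee\epsilon(\mathsf{univ}))^{\omega},\qquad \mathbf{demand}\,r = (\pi(\mathsf{univ})\vee\epsilon(r))^{\omega},\qquad \mathbf{promise}\,r = (\pi(r)\vee\epsilon(r))^{\omega}. \] Let $\mathrm{pre}\,p=\{(\sigma_0,\sigma)\mid \sigma_0\in p\}$, $\mathrm{post}\,p=\{(\sigma_0,\sigma)\mid \sigma\in p\}$, $(r_1\Rightarrow r_2)=\overline{r_1}\cup r_2$ and $\mathbf{inv}\,I=\{I\};\mathbf{promise}(\mathrm{post}\,I)$. For a set $V$ of variables, $\mathrm{id}_V$ is the relation that holds between two states iff they agree on every variable in $V$; $\mathrm{id}_v=\mathrm{id}_{\{v\}}$ and $\mathrm{id}_{w,v}=\mathrm{id}_{\{w,v\}}$. For a variable $v$, $\exists v.\,p$ is the set of states that equal some state of $p$ except possibly for the value of $v$, and $\exists v.\,c$ is the command with the traces that equal some trace of $c$ except possibly for the value of $v$ in each state. The local block is \[ \mathbf{local}\ v.\,c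 \;=\; \mathbf{guar}\,\mathrm{id}_v \Cap \exists v.\,(\mathbf{demand}\,\mathrm{id}_v \Cap c). \] \textbf{Lemma.} Let $v\neq w$ be variables and let $I$ be a set of states with $\mathrm{id}_{w,v}\subseteq(\mathrm{pre}\,I\Rightarrow\mathrm{post}\,I)$. Then \[ \bigl(\mathbf{local}\ v.\ \lceil I\rceil;\mathbf{inv}\,I\bigr)\Cap\mathbf{demand}\,\mathrm{id}_w \;\succeq\; \bigl(\lceil\exists v.I\rceil;\mathbf{guar}(\mathrm{pre}(\exists v.I)\Rightarrow\mathrm{post}(\exists v.I))\bigr)\Cap\mathbf{demand}\,\mathrm{id}_w\Cap\mathbf{guar}\,\mathrm{id}_v . \] -/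

import Mathlib

/-!
Commands of a rely/guarantee wide-spectrum language, as sets of Aczel traces.
A state maps variables to values.  A trace starts in an initial state and performs finitely or
infinitely many transitions, each of which is made either by the program or by its environment.
A finite trace has terminated, has aborted, or is incomplete (it has so far done nothing else).
-/

namespace AczelAlgebra

/-- Who makes a transition: the program (`π`) or its environment (`ε`). -/
inductive Kind : Type
  | pgm
  | env

/-- The status of a finite trace. -/
inductive Ending : Type
  | terminated
  | aborted
  | incomplete

/-- A transition: its kind and the state it ends in. -/
abbrev Step (S : Type*) : Type _ := Kind × S

/-- What happens from the initial state on: finitely many transitions and a final status, or an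
infinite sequence of transitions. -/
inductive Run (S : Type*) : Type _
  | fin (l : List (Step S)) (e : Ending)
  | inf (s : Stream' (Step S))

/-- A trace. -/
structure Trace (S : Type*) : Type _ where
  init : S
  run : Run S

/-- Perform the transitions `l` first, then the run. -/
def Run.after {S : Type*} (l : List (Step S)) : Run S → Run S
  | .fin m e => .fin (l ++ m) e
  | .inf s => .inf (l ++ₛ s)

/-- The state reached from `σ` by the transitions `l`. -/
def lastState {S : Type*} (σ : S) (l : List (Step S)) : S :=
  l.foldl (fun _ a => a.2) σ

theorem Run.after_append {S : Type*} (l m : List (Step S)) (r : Run S) :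
    Run.after (l ++ m) r = Run.after l (Run.after m r) := by
  cases r with
  | fin k e => simp [Run.after, List.append_assoc]
  | inf s => simp [Run.after, Stream'.append_append_stream]

/-- A command is a set of traces that
* contains the incomplete trace without transitions, from every initial state (so that a command
  that is infeasible in a state has that trace, and no other trace, from that state);
* contains every incomplete finite prefix of each of its traces;
* contains every extension of each of its aborting traces. -/
structure Cmd (S : Type*) : Type _ where
  traces : Set (Trace S)
  empty_mem : ∀ σ, (⟨σ, .fin [] .incomplete⟩ : Trace S) ∈ traces
  prefix_mem : ∀ σ l r, (⟨σ, Run.after l r⟩ : Trace S) ∈ traces →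
    (⟨σ, .fin l .incomplete⟩ : Trace S) ∈ traces
  abort_mem : ∀ σ l r, (⟨σ, .fin l .aborted⟩ : Trace S) ∈ traces →
    (⟨σ, Run.after l r⟩ : Trace S) ∈ traces

theorem Cmd.ext' {S : Type*} {c d : Cmd S} (h : c.traces = d.traces) : c = d := by
  cases c; cases d; cases h; rfl

/-- `d ≤ c` is inclusion of trace sets. -/
instance {S : Type*} : PartialOrder (Cmd S) where
  le d c := d.traces ⊆ c.traces
  le_refl _ := subset_rfl
  le_trans _ _ _ h k := Set.Subset.trans h k
  le_antisymm _ _ h k := Cmd.ext' (Set.Subset.antisymm h k)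

/-- `c ⪰ d`: the command `c` is refined (implemented) by the command `d`. -/
def Refines {S : Type*} (c d : Cmd S) : Prop := d ≤ c

infix:50 " ⪰ " => Refines

theorem Run.after_eq_nil {S : Type*} {l : List (Step S)} {r : Run S} {e : Ending}
    (h : Run.after l r = .fin [] e) : l = [] := by
  cases r with
  | fin m e' =>
    simp only [Run.after, Run.fin.injEq, List.append_eq_nil_iff] at h
    exact h.1.1
  | inf s => simp [Run.after] at h

theorem Run.after_nil {S : Type*} (r : Run S) : Run.after [] r = r := by
  cases r <;> rfl

theorem Run.after_cons_inj {S : Type*} {a b : Step S} {l m : List (Step S)} {r q : Run S}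
    (h : Run.after (a :: l) r = Run.after (b :: m) q) :
    a = b ∧ Run.after l r = Run.after m q := by
  cases r <;> cases q <;> simp only [Run.after, List.cons_append, Run.fin.injEq, List.cons.injEq,
    Run.inf.injEq, reduceCtorEq, Stream'.cons_append_stream] at h ⊢
  · exact ⟨h.1.1, h.1.2, h.2⟩
  · exact Stream'.cons_injective2 h

/-- Two ways to split a run: one of the two initial parts is a prefix of the other. -/
theorem Run.after_eq_after {S : Type*} : ∀ {l m : List (Step S)} {r q : Run S},
    Run.after l r = Run.after m q →
      (∃ k, m = l ++ k) ∨ ∃ k, l = m ++ k ∧ q = Run.after k r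
  | [], m, _, _, _ => Or.inl ⟨m, rfl⟩
  | a :: l, [], _, _, h => Or.inr ⟨a :: l, rfl, by rw [h, Run.after_nil]⟩
  | a :: l, b :: m, _, _, h => by
    obtain ⟨rfl, h'⟩ := Run.after_cons_inj h
    rcases Run.after_eq_after h' with ⟨k, rfl⟩ | ⟨k, rfl, hk⟩
    · exact Or.inl ⟨k, rfl⟩
    · exact Or.inr ⟨k, rfl, hk⟩

/-- The traces of the infeasible command, the least command. -/
def idleTraces (S : Type*) : Set (Trace S) := {t | t.run = .fin [] .incomplete}

/-- Non-deterministic choice is union and strong conjunction is intersection of trace sets;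
the greatest command has all traces. -/
instance {S : Type*} : CompleteLattice (Cmd S) where
  sup c d :=
    { traces := c.traces ∪ d.traces
      empty_mem := fun σ => Or.inl (c.empty_mem σ)
      prefix_mem := fun σ l r h => h.imp (c.prefix_mem σ l r) (d.prefix_mem σ l r)
      abort_mem := fun σ l r h => h.imp (c.abort_mem σ l r) (d.abort_mem σ l r) }
  le_sup_left _ _ := Set.subset_union_left
  le_sup_right _ _ := Set.subset_union_right
  sup_le _ _ _ h k := Set.union_subset h k
  inf c d :=
    { traces := c.traces ∩ d.traces
      empty_mem := fun σ => ⟨c.empty_mem σ, d.empty_mem σ⟩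
      prefix_mem := fun σ l r h => h.imp (c.prefix_mem σ l r) (d.prefix_mem σ l r)
      abort_mem := fun σ l r h => h.imp (c.abort_mem σ l r) (d.abort_mem σ l r) }
  inf_le_left _ _ := Set.inter_subset_left
  inf_le_right _ _ := Set.inter_subset_right
  le_inf _ _ _ h k := Set.subset_inter h k
  sSup C :=
    { traces := idleTraces S ∪ {t | ∃ c ∈ C, t ∈ c.traces}
      empty_mem := fun σ => Or.inl rfl
      prefix_mem := by
        rintro σ l r (h | ⟨c, hc, h⟩)
        · left
          have h' : Run.after l r = .fin [] .incomplete := h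
          simp [idleTraces, Run.after_eq_nil h']
        · exact Or.inr ⟨c, hc, c.prefix_mem σ l r h⟩
      abort_mem := by
        rintro σ l r (h | ⟨c, hc, h⟩)
        · simp [idleTraces] at h
        · exact Or.inr ⟨c, hc, c.abort_mem σ l r h⟩ }
  isLUB_sSup C := by
    refine ⟨fun c hc t ht => Or.inr ⟨c, hc, ht⟩, fun d hd t ht => ?_⟩
    rcases ht with h | ⟨c, hc, h⟩
    · obtain ⟨σ, r⟩ := t
      have h' : r = .fin [] .incomplete := h
      subst h'
      exact d.empty_mem σ
    · exact hd hc h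
  sInf C :=
    { traces := {t | ∀ c ∈ C, t ∈ c.traces}
      empty_mem := fun σ c _ => c.empty_mem σ
      prefix_mem := fun σ l r h c hc => c.prefix_mem σ l r (h c hc)
      abort_mem := fun σ l r h c hc => c.abort_mem σ l r (h c hc) }
  isGLB_sInf C := ⟨fun c hc _ ht => ht c hc, fun d hd _ ht c hc => hd hc ht⟩
  top :=
    { traces := Set.univ
      empty_mem := fun _ => trivial
      prefix_mem := fun _ _ _ _ => trivial
      abort_mem := fun _ _ _ _ => trivial }
  le_top _ := Set.subset_univ _
  bot :=
    { traces := idleTraces S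
      empty_mem := fun _ => rfl
      prefix_mem := by
        intro σ l r h
        have h' : Run.after l r = .fin [] .incomplete := h
        simp [idleTraces, Run.after_eq_nil h']
      abort_mem := by
        intro σ l r h
        simp [idleTraces] at h }
  bot_le d := by
    rintro ⟨σ, r⟩ h
    have h' : r = .fin [] .incomplete := h
    subst h'
    exact d.empty_mem σ

/-! ### Primitive commands -/

section Primitive

variable {S : Type*}

/-- The command that aborts at once: the greatest command. -/
def abort : Cmd S := ⊤

/-- The instantaneous test `⌈p⌉`: it terminates at once from the states in `p`, and is infeasible
from the other states. -/
def test (p : Set S) : Cmd S where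
  traces := idleTraces S ∪ {t | t.init ∈ p ∧ t.run = .fin [] .terminated}
  empty_mem _ := Or.inl rfl
  prefix_mem := by
    rintro σ l r (h | ⟨-, h⟩)
    · have h' : Run.after l r = .fin [] .incomplete := h
      left; simp [idleTraces, Run.after_eq_nil h']
    · have h' : Run.after l r = .fin [] .terminated := h
      left; simp [idleTraces, Run.after_eq_nil h']
  abort_mem := by
    rintro σ l r (h | ⟨-, h⟩)
    · simp [idleTraces] at h
    · simp at h

/-- One transition of kind `k` that satisfies `r`, and then termination. -/
def atomic (k : Kind) (r : Set (S × S)) : Cmd S where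
  traces := idleTraces S ∪ {t | ∃ σ', (t.init, σ') ∈ r ∧
    (t.run = .fin [(k, σ')] .terminated ∨ t.run = .fin [(k, σ')] .incomplete)}
  empty_mem _ := Or.inl rfl
  prefix_mem := by
    rintro σ l q (h | ⟨σ', hr, h⟩)
    · have h' : Run.after l q = .fin [] .incomplete := h
      left; simp [idleTraces, Run.after_eq_nil h']
    · cases q with
      | inf s => simp [Run.after] at h
      | fin m e =>
        have h' : l ++ m = [(k, σ')] := by
          rcases h with h | h <;> simp only [Run.after, Run.fin.injEq] at h <;> exact h.1
        rcases l with _ | ⟨a, l⟩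
        · exact Or.inl rfl
        · simp only [List.cons_append, List.cons.injEq, List.append_eq_nil_iff] at h'
          obtain ⟨rfl, rfl, -⟩ := h'
          exact Or.inr ⟨σ', hr, Or.inr rfl⟩
  abort_mem := by
    rintro σ l q (h | ⟨σ', -, h | h⟩)
    · simp [idleTraces] at h
    · simp at h
    · simp at h

/-- The atomic program command `π(r)`. -/
def pstep (r : Set (S × S)) : Cmd S := atomic .pgm r

/-- The atomic environment command `ε(r)`. -/
def estep (r : Set (S × S)) : Cmd S := atomic .env r

/-! ### Composition -/

/-- Sequential composition: a trace of `c` that has not terminated, or an extension of a trace in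
which `c` aborts, or a terminated trace of `c` followed by a trace of `d` from the state reached. -/
def seq (c d : Cmd S) : Cmd S where
  traces :=
    {t | t ∈ c.traces ∧ ∀ l, t.run ≠ .fin l .terminated} ∪
    {t | ∃ l q, t.run = Run.after l q ∧ (⟨t.init, .fin l .aborted⟩ : Trace S) ∈ c.traces} ∪
    {t | ∃ l q, t.run = Run.after l q ∧ (⟨t.init, .fin l .terminated⟩ : Trace S) ∈ c.traces ∧
      (⟨lastState t.init l, q⟩ : Trace S) ∈ d.traces}
  empty_mem σ := Or.inl (Or.inl ⟨c.empty_mem σ, by simp⟩)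
  prefix_mem := by
    rintro σ l r ((⟨h, -⟩ | ⟨m, q, h, hc⟩) | ⟨m, q, h, hc, hd⟩)
    · exact Or.inl (Or.inl ⟨c.prefix_mem σ l r h, by simp⟩)
    · refine Or.inl (Or.inl ⟨c.prefix_mem σ l r ?_, by simp⟩)
      have h' : Run.after l r = Run.after m q := h
      rw [h']
      exact c.abort_mem σ m q hc
    · rcases Run.after_eq_after h with ⟨k, rfl⟩ | ⟨k, rfl, rfl⟩
      · exact Or.inl (Or.inl ⟨c.prefix_mem σ l (.fin k .terminated) hc, by simp⟩)
      · exact Or.inr ⟨m, .fin k .incomplete, rfl, hc, d.prefix_mem _ k r hd⟩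
  abort_mem := by
    rintro σ l r ((⟨h, -⟩ | ⟨m, q, h, hc⟩) | ⟨m, q, h, hc, hd⟩)
    · exact Or.inl (Or.inr ⟨l, r, rfl, h⟩)
    · cases q with
      | inf s => simp [Run.after] at h
      | fin b e =>
        simp only [Run.after, Run.fin.injEq] at h
        obtain ⟨rfl, rfl⟩ := h
        exact Or.inl (Or.inr ⟨m, Run.after b r, Run.after_append m b r, hc⟩)
    · cases q with
      | inf s => simp [Run.after] at h
      | fin b e =>
        simp only [Run.after, Run.fin.injEq] at h
        obtain ⟨rfl, rfl⟩ := h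
        exact Or.inr ⟨m, Run.after b r, Run.after_append m b r, hc, d.abort_mem _ b r hd⟩

infixr:80 " ⨾ " => seq

/-- Weak conjunction: a trace of both commands, or any extension of a trace in which one of the
commands aborts while the other command has the same transitions. -/
def wconj (c d : Cmd S) : Cmd S where
  traces := (c.traces ∩ d.traces) ∪ {t | ∃ l q, t.run = Run.after l q ∧
    (((⟨t.init, .fin l .aborted⟩ : Trace S) ∈ c.traces ∧
        (⟨t.init, .fin l .incomplete⟩ : Trace S) ∈ d.traces) ∨
      ((⟨t.init, .fin l .incomplete⟩ : Trace S) ∈ c.traces ∧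
        (⟨t.init, .fin l .aborted⟩ : Trace S) ∈ d.traces))}
  empty_mem σ := Or.inl ⟨c.empty_mem σ, d.empty_mem σ⟩
  prefix_mem := by
    rintro σ l r (⟨hc, hd⟩ | ⟨m, q, h, hcd⟩)
    · exact Or.inl ⟨c.prefix_mem σ l r hc, d.prefix_mem σ l r hd⟩
    · rcases Run.after_eq_after h with ⟨k, rfl⟩ | ⟨k, rfl, rfl⟩
      · left
        rcases hcd with ⟨hc, hd⟩ | ⟨hc, hd⟩
        · exact ⟨c.prefix_mem σ l (.fin k _) hc, d.prefix_mem σ l (.fin k _) hd⟩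
        · exact ⟨c.prefix_mem σ l (.fin k _) hc, d.prefix_mem σ l (.fin k _) hd⟩
      · exact Or.inr ⟨m, .fin k .incomplete, rfl, hcd⟩
  abort_mem := by
    rintro σ l r (⟨hc, hd⟩ | ⟨m, q, h, hcd⟩)
    · exact Or.inl ⟨c.abort_mem σ l r hc, d.abort_mem σ l r hd⟩
    · cases q with
      | inf s => simp [Run.after] at h
      | fin b e =>
        simp only [Run.after, Run.fin.injEq] at h
        obtain ⟨rfl, rfl⟩ := h
        exact Or.inr ⟨m, Run.after b r, Run.after_append m b r, hcd⟩

infixl:70 " ⋒ " => wconj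

/-! ### Derived commands -/

/-- The command `τ`: the test that always succeeds. -/
def nil : Cmd S := test Set.univ

/-- The assertion `{p}`: it aborts from the states outside `p`, and is a no-op otherwise. -/
def assertion (p : Set S) : Cmd S := nil ⊔ test pᶜ ⨾ abort

/-- The command `α(r)`: a program or environment transition that satisfies `r`. -/
def anystep (r : Set (S × S)) : Cmd S := pstep r ⊔ estep r

theorem seq_mono_right (c : Cmd S) : Monotone (seq c) := by
  rintro d d' h t ((ht | ht) | ⟨l, q, hl, hc, hd⟩)
  · exact Or.inl (Or.inl ht)
  · exact Or.inl (Or.inr ht)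
  · exact Or.inr ⟨l, q, hl, hc, h hd⟩

/-- Possibly infinite iteration: the greatest fixed point of `y ↦ τ ∨ c ; y`. -/
def iter (c : Cmd S) : Cmd S :=
  OrderHom.gfp ⟨fun y => nil ⊔ c ⨾ y, fun _ _ h => sup_le_sup_left (seq_mono_right c h) _⟩

/-- The program guarantee: every program transition satisfies `r`. -/
def guar (r : Set (S × S)) : Cmd S := iter (pstep r ⊔ estep Set.univ)

/-- The environment guarantee: every environment transition satisfies `r`. -/
def demand (r : Set (S × S)) : Cmd S := iter (pstep Set.univ ⊔ estep r)

/-- The promise: every transition, of the program or of the environment, satisfies `r`. -/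
def promise (r : Set (S × S)) : Cmd S := iter (anystep r)

/-! ### Relations and invariants -/

/-- The pairs of states whose initial state is in `p`. -/
def preR (p : Set S) : Set (S × S) := {a | a.1 ∈ p}

/-- The pairs of states whose final state is in `p`. -/
def postR (p : Set S) : Set (S × S) := {a | a.2 ∈ p}

/-- Implication between relations. -/
def impR (r₁ r₂ : Set (S × S)) : Set (S × S) := r₁ᶜ ∪ r₂

/-- The command `inv I`: it assumes `I` initially, and every transition establishes `I`. -/
def invariant (I : Set S) : Cmd S := assertion I ⨾ promise (postR I)

end Primitive

/-! ### Variables -/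

section Variables

variable {Var Val : Type*}

/-- The relation `id_V`: no variable in `V` changes (the other variables are unconstrained). -/
def idOn (V : Set Var) : Set ((Var → Val) × (Var → Val)) := {a | ∀ x ∈ V, a.2 x = a.1 x}

/-- Equality of two states except possibly for the value of the variable `v`. -/
def EqOff (v : Var) (σ σ' : Var → Val) : Prop := ∀ x, x ≠ v → σ x = σ' x

/-- Existential quantification `∃v. p` of a set of states. -/
def hideS (v : Var) (p : Set (Var → Val)) : Set (Var → Val) := {σ | ∃ σ' ∈ p, EqOff v σ σ'}

/-- Two transitions of the same kind whose final states are equal except for the value of `v`. -/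
def StepEqOff (v : Var) (a b : Step (Var → Val)) : Prop := a.1 = b.1 ∧ EqOff v a.2 b.2

/-- Two runs that are the same except for the value of `v` in each state. -/
def Run.EqOff (v : Var) : Run (Var → Val) → Run (Var → Val) → Prop
  | .fin l e, .fin l' e' => List.Forall₂ (StepEqOff v) l l' ∧ e = e'
  | .inf s, .inf s' => ∀ n, StepEqOff v (s.get n) (s'.get n)
  | _, _ => False

/-- Two traces that are the same except for the value of `v` in each state. -/
def Trace.EqOff (v : Var) (t t' : Trace (Var → Val)) : Prop :=
  AczelAlgebra.EqOff v t.init t'.init ∧ Run.EqOff v t.run t'.run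

theorem StepEqOff.refl (v : Var) (a : Step (Var → Val)) : StepEqOff v a a :=
  ⟨rfl, fun _ _ => rfl⟩

theorem Run.EqOff.refl (v : Var) : ∀ r : Run (Var → Val), Run.EqOff v r r
  | .fin _ _ => ⟨List.forall₂_same.2 fun a _ => StepEqOff.refl v a, rfl⟩
  | .inf _ => fun _ => StepEqOff.refl v _

theorem Run.EqOff.append {v : Var} : ∀ {l l' : List (Step (Var → Val))},
    List.Forall₂ (StepEqOff v) l l' → ∀ {r r' : Run (Var → Val)}, Run.EqOff v r r' →
      Run.EqOff v (Run.after l r) (Run.after l' r')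
  | _, _, hl, .fin m e, .fin m' e', h => ⟨List.rel_append hl h.1, h.2⟩
  | _, _, .nil, .inf s, .inf s', h => h
  | _, _, .cons ha hl, .inf s, .inf s', h => by
    intro n
    cases n with
    | zero => exact ha
    | succ n => exact Run.EqOff.append hl (r := .inf s) (r' := .inf s') h n
  | _, _, _, .fin _ _, .inf _, h => h.elim
  | _, _, _, .inf _, .fin _ _, h => h.elim

theorem Run.EqOff.split {v : Var} : ∀ {l : List (Step (Var → Val))} {r r' : Run (Var → Val)},
    Run.EqOff v (Run.after l r) r' →
      ∃ l' q, r' = Run.after l' q ∧ List.Forall₂ (StepEqOff v) l l'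
  | [], _, r', _ => ⟨[], r', (Run.after_nil r').symm, .nil⟩
  | _ :: _, .fin _ _, .fin [] _, h => by cases h.1
  | a :: l, .fin m e, .fin (b :: m') e', h => by
    obtain ⟨h1, h2⟩ := h
    obtain ⟨hab, hl⟩ := List.forall₂_cons.1 h1
    obtain ⟨l', q, hq, hl'⟩ :=
      Run.EqOff.split (l := l) (r := .fin m e) (r' := .fin m' e') ⟨hl, h2⟩
    refine ⟨b :: l', q, ?_, .cons hab hl'⟩
    change _ = Run.after ([b] ++ l') q
    rw [Run.after_append, ← hq]
    rfl
  | a :: l, .inf s, .inf s', h => by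
    obtain ⟨l', q, hq, hl'⟩ :=
      Run.EqOff.split (l := l) (r := .inf s) (r' := .inf s'.tail) fun n => h (n + 1)
    refine ⟨s'.head :: l', q, ?_, .cons (h 0) hl'⟩
    change _ = Run.after ([s'.head] ++ l') q
    rw [Run.after_append, ← hq]
    simp only [Run.after, Stream'.cons_append_stream, Stream'.nil_append_stream]
    rw [Stream'.eta]
  | _ :: _, .fin _ _, .inf _, h => h.elim
  | _ :: _, .inf _, .fin _ _, h => h.elim

/-- Existential quantification `∃v. c` of a command: the traces that are the same as some trace of
`c` except for the value of `v` in each state. -/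
def hide (v : Var) (c : Cmd (Var → Val)) : Cmd (Var → Val) where
  traces := {t | ∃ t' ∈ c.traces, t.EqOff v t'}
  empty_mem σ := ⟨_, c.empty_mem σ, fun _ _ => rfl, .nil, rfl⟩
  prefix_mem := by
    rintro σ l r ⟨⟨σ', r'⟩, ht, hσ, hr⟩
    obtain ⟨l', q, hq, hl⟩ := Run.EqOff.split hr
    dsimp only at hq
    subst hq
    exact ⟨⟨σ', .fin l' .incomplete⟩, c.prefix_mem σ' l' q ht, hσ, hl, rfl⟩
  abort_mem := by
    rintro σ l r ⟨⟨σ', r'⟩, ht, hσ, hr⟩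
    cases r' with
    | inf s => exact hr.elim
    | fin l' e =>
      obtain ⟨hl, rfl⟩ := hr
      exact ⟨⟨σ', Run.after l' r⟩, c.abort_mem σ' l' r ht, hσ,
        Run.EqOff.append hl (Run.EqOff.refl v r)⟩

/-- The local block `local v. c`: program transitions do not change the outer `v`, and environment
transitions do not change the local `v`, which is hidden. -/
def localBlock (v : Var) (c : Cmd (Var → Val)) : Cmd (Var → Val) :=
  guar (idOn {v}) ⋒ hide v (demand (idOn {v}) ⋒ c)

end Variables

end AczelAlgebra

open AczelAlgebra

/-! Refinement is inclusion of trace sets, so each trace of the right-hand side has to be found on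
the left. By `iter_pstep_sup_estep`, guarantees, demands and promises all describe non-aborting
traces constrained transition by transition; by `traces_wconj`, weak conjunction of abort-free
commands is intersection. The outer `guar` and `demand` constraints on the left are then already
given, and what remains is to choose values of the hidden `v` along the trace.

`exists_eqOff_follows` chooses them, keeping the hidden state in `I`. After a program transition the
outer state lies in `∃v. I`, so a witness in `I` exists and `v` may take its value. During an
environment transition the hidden `v` is frozen; as `w` is also unchanged, the hypothesis on
`id_{w,v}` preserves `I`. `Follows.simulate` turns these one-step choices into a whole run, finite
or infinite. -/

namespace AczelAlgebra

/-! ### Runs constrained transition by transition -/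

section Follows

variable {S : Type*}

/-- The state before the transition with number `n` of an infinite run from `σ`. -/
def stateAt (σ : S) (s : Stream' (Step S)) : ℕ → S
  | 0 => σ
  | n + 1 => (s.get n).2

/-- Every transition of kind `k` in the list, performed from `σ`, satisfies `R k`. -/
def FollowsList (R : Kind → Set (S × S)) : S → List (Step S) → Prop
  | _, [] => True
  | σ, a :: l => (σ, a.2) ∈ R a.1 ∧ FollowsList R a.2 l

/-- The run from `σ` does not abort, and every transition of kind `k` satisfies `R k`. -/
def Follows (R : Kind → Set (S × S)) (σ : S) : Run S → Prop
  | .fin l e => FollowsList R σ l ∧ e ≠ .aborted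
  | .inf s => ∀ n, (stateAt σ s n, (s.get n).2) ∈ R (s.get n).1

theorem stateAt_cons_succ (σ : S) (a : Step S) (s : Stream' (Step S)) :
    ∀ n, stateAt σ (Stream'.cons a s) (n + 1) = stateAt a.2 s n
  | 0 => rfl
  | _ + 1 => rfl

theorem follows_cons {R : Kind → Set (S × S)} {σ : S} {a : Step S} {q : Run S} :
    Follows R σ (Run.after [a] q) ↔ (σ, a.2) ∈ R a.1 ∧ Follows R a.2 q := by
  cases q with
  | fin l e => exact and_assoc
  | inf s =>
    constructor
    · intro h
      refine ⟨h 0, fun n => ?_⟩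
      have := h (n + 1)
      rwa [show stateAt σ ([a] ++ₛ s) (n + 1) = stateAt a.2 s n from
        stateAt_cons_succ σ a s n] at this
    · rintro ⟨h, k⟩ (_ | n)
      · exact h
      · have := k n
        rwa [← stateAt_cons_succ σ a s n] at this

theorem Follows.list_of_after {R : Kind → Set (S × S)} {q : Run S} :
    ∀ {l : List (Step S)} {σ : S}, Follows R σ (Run.after l q) → FollowsList R σ l
  | [], _, _ => trivial
  | a :: l, σ, h => by
    rw [← List.singleton_append, Run.after_append, follows_cons] at h
    exact ⟨h.1, h.2.list_of_after⟩

theorem FollowsList.mono {R R' : Kind → Set (S × S)} (h : ∀ k, R k ⊆ R' k) :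
    ∀ {l : List (Step S)} {σ : S}, FollowsList R σ l → FollowsList R' σ l
  | [], _, _ => trivial
  | _ :: _, _, hl => ⟨h _ hl.1, hl.2.mono h⟩

theorem Follows.mono {R R' : Kind → Set (S × S)} (h : ∀ k, R k ⊆ R' k) {σ : S} :
    ∀ {r : Run S}, Follows R σ r → Follows R' σ r
  | .fin _ _, hr => ⟨hr.1.mono h, hr.2⟩
  | .inf _, hr => fun n => h _ (hr n)

theorem FollowsList.inter {R R' : Kind → Set (S × S)} :
    ∀ {l : List (Step S)} {σ : S}, FollowsList R σ l → FollowsList R' σ l →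
      FollowsList (fun k => R k ∩ R' k) σ l
  | [], _, _, _ => trivial
  | _ :: _, _, h, h' => ⟨⟨h.1, h'.1⟩, h.2.inter h'.2⟩

theorem Follows.inter {R R' : Kind → Set (S × S)} {σ : S} :
    ∀ {r : Run S}, Follows R σ r → Follows R' σ r → Follows (fun k => R k ∩ R' k) σ r
  | .fin _ _, h, h' => ⟨h.1.inter h'.1, h.2⟩
  | .inf _, h, h' => fun n => ⟨h n, h' n⟩

/-- The command with the non-aborting traces whose transitions of kind `k` satisfy `R k`. -/
def followCmd (R : Kind → Set (S × S)) : Cmd S where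
  traces := {t | Follows R t.init t.run}
  empty_mem _ := ⟨trivial, by simp⟩
  prefix_mem _ _ _ h := ⟨h.list_of_after, by simp⟩
  abort_mem _ _ _ h := absurd rfl h.2

/-! ### Iterated atomic steps -/

/-- The relations for program and environment transitions, as a function of the kind. -/
def kindRel (r q : Set (S × S)) : Kind → Set (S × S)
  | .pgm => r
  | .env => q

theorem mem_pstep_sup_estep {r q : Set (S × S)} {t : Trace S} :
    t ∈ (pstep r ⊔ estep q).traces ↔ t.run = .fin [] .incomplete ∨
      ∃ a : Step S, (t.init, a.2) ∈ kindRel r q a.1 ∧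
        (t.run = .fin [a] .terminated ∨ t.run = .fin [a] .incomplete) := by
  constructor
  · rintro ((h | ⟨σ, h⟩) | (h | ⟨σ, h⟩))
    · exact Or.inl h
    · exact Or.inr ⟨(.pgm, σ), h⟩
    · exact Or.inl h
    · exact Or.inr ⟨(.env, σ), h⟩
  · rintro (h | ⟨⟨_ | _, σ⟩, h⟩)
    · exact Or.inl (Or.inl h)
    · exact Or.inl (Or.inr ⟨σ, h⟩)
    · exact Or.inr (Or.inr ⟨σ, h⟩)

theorem iter_unfold (c : Cmd S) : iter c = nil ⊔ c ⨾ iter c :=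
  (OrderHom.map_gfp (⟨fun y => nil ⊔ c ⨾ y, fun _ _ h =>
    sup_le_sup_left (seq_mono_right c h) _⟩ : Cmd S →o Cmd S)).symm

theorem le_iter {c d : Cmd S} (h : d ≤ nil ⊔ c ⨾ d) : d ≤ iter c :=
  OrderHom.le_gfp _ h

/-- A trace of an iterated step has no transitions and is not aborted, or it makes a transition
and goes on as a trace of the iterated step. -/
theorem cases_of_mem_iter {r q : Set (S × S)} {σ : S} {u : Run S}
    (h : (⟨σ, u⟩ : Trace S) ∈ (iter (pstep r ⊔ estep q)).traces) :
    (∃ e, u = .fin [] e ∧ e ≠ .aborted) ∨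
      ∃ a u', u = Run.after [a] u' ∧ (σ, a.2) ∈ kindRel r q a.1 ∧
        (⟨a.2, u'⟩ : Trace S) ∈ (iter (pstep r ⊔ estep q)).traces := by
  rw [iter_unfold] at h
  rcases h with (h | ⟨-, h⟩) | ((⟨h, hn⟩ | ⟨l, x, -, h⟩) | ⟨l, x, hu, h, hd⟩)
  · exact Or.inl ⟨_, h, by simp⟩
  · exact Or.inl ⟨_, h, by simp⟩
  · rcases mem_pstep_sup_estep.1 h with h | ⟨a, ha, h | h⟩
    · exact Or.inl ⟨_, h, by simp⟩
    · exact absurd h (hn _)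
    -- The step is cut off before terminating; the rest of the run is the empty incomplete trace,
    -- which every command has.
    · exact Or.inr ⟨a, .fin [] .incomplete, h, ha, Cmd.empty_mem _ _⟩
  · rcases mem_pstep_sup_estep.1 h with h | ⟨a, ha, h | h⟩ <;> simp at h
  · rcases mem_pstep_sup_estep.1 h with h | ⟨a, ha, h | h⟩ <;> simp at h
    subst h
    exact Or.inr ⟨a, x, hu, ha, hd⟩

theorem followsList_of_mem_iter {r q : Set (S × S)} :
    ∀ {l : List (Step S)} {e : Ending} {σ : S},
      (⟨σ, .fin l e⟩ : Trace S) ∈ (iter (pstep r ⊔ estep q)).traces →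
        FollowsList (kindRel r q) σ l ∧ e ≠ .aborted
  | [], e, σ, h => by
    rcases cases_of_mem_iter h with ⟨e', he, hne⟩ | ⟨a, u, hu, -⟩
    · cases he
      exact ⟨trivial, hne⟩
    · exact absurd (Run.after_eq_nil hu.symm) (by simp)
  | b :: l, e, σ, h => by
    rcases cases_of_mem_iter h with ⟨e', he, -⟩ | ⟨a, u, hu, ha, h'⟩
    · simp at he
    · obtain ⟨rfl, hl⟩ := Run.after_cons_inj (l := []) (m := []) (r := .fin l e) hu
      rw [Run.after_nil, Run.after_nil] at hl
      subst hl
      have := followsList_of_mem_iter h'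
      exact ⟨⟨ha, this.1⟩, this.2⟩

/-- An infinite run offers no structural induction, so the position is fixed and induction runs on
it, with the run and its initial state left general: each unfolding shifts both by one transition.
-/
theorem mem_of_inf_mem_iter {r q : Set (S × S)} (n : ℕ) :
    ∀ {s : Stream' (Step S)} {σ : S},
      (⟨σ, .inf s⟩ : Trace S) ∈ (iter (pstep r ⊔ estep q)).traces →
        (stateAt σ s n, (s.get n).2) ∈ kindRel r q (s.get n).1 := by
  induction n with
  | zero =>
    intro s σ h
    rcases cases_of_mem_iter h with ⟨e', he, -⟩ | ⟨a, u, hu, ha, -⟩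
    · simp at he
    · cases u with
      | fin m e => simp [Run.after] at hu
      | inf s' => cases hu; exact ha
  | succ n ih =>
    intro s σ h
    rcases cases_of_mem_iter h with ⟨e', he, -⟩ | ⟨a, u, hu, -, h'⟩
    · simp at he
    · cases u with
      | fin m e => simp [Run.after] at hu
      | inf s' =>
        cases hu
        have := ih h'
        rwa [← stateAt_cons_succ σ a s' n] at this

/-- One inclusion unfolds the fixed point along the trace. The other is coinduction: the right-hand
side is a post-fixed point of `y ↦ τ ∨ c ; y`, hence below the greatest fixed point, which also
covers infinite runs. -/
theorem iter_pstep_sup_estep (r q : Set (S × S)) :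
    iter (pstep r ⊔ estep q) = followCmd (kindRel r q) := by
  apply le_antisymm
  · rintro ⟨σ, l | s⟩ h
    · exact followsList_of_mem_iter h
    · exact fun n => mem_of_inf_mem_iter n h
  · apply le_iter
    have step : ∀ (σ : S) (a : Step S) (u : Run S), Follows (kindRel r q) σ (Run.after [a] u) →
        (⟨σ, Run.after [a] u⟩ : Trace S) ∈
          ((pstep r ⊔ estep q) ⨾ followCmd (kindRel r q)).traces := by
      intro σ a u h
      rw [follows_cons] at h
      exact Or.inr ⟨[a], u, rfl, mem_pstep_sup_estep.2 (Or.inr ⟨a, h.1, Or.inl rfl⟩), h.2⟩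
    rintro ⟨σ, ⟨_ | ⟨a, l⟩, e⟩ | s⟩ h
    · cases e with
      | terminated => exact Or.inl (Or.inr ⟨trivial, rfl⟩)
      | aborted => exact absurd rfl h.2
      | incomplete => exact Or.inl (Or.inl rfl)
    · exact Or.inr (step σ a (.fin l e) h)
    · have hs : (Run.inf s : Run S) = Run.after [s.head] (.inf s.tail) :=
        congrArg Run.inf (Stream'.eta s).symm
      rw [hs]
      exact Or.inr (step σ s.head (.inf s.tail) (by rw [← hs]; exact h))

/-! ### Simulation -/

/-- A stepwise simulation lifts to runs: a run that follows `R` from `σ` is matched, state by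
state, by a run that follows `R'` from a related state. -/
theorem Follows.simulate {R R' : Kind → Set (S × S)} {Sim : S → S → Prop}
    (hstep : ∀ σ σ' (a : Step S), Sim σ σ' → (σ, a.2) ∈ R a.1 →
      ∃ ρ', Sim a.2 ρ' ∧ (σ', ρ') ∈ R' a.1) :
    ∀ {u : Run S} {σ σ' : S}, Follows R σ u → Sim σ σ' →
      match u with
      | .fin l e => ∃ l', Follows R' σ' (.fin l' e) ∧
          List.Forall₂ (fun a b : Step S => a.1 = b.1 ∧ Sim a.2 b.2) l l'
      | .inf s => ∃ s', Follows R' σ' (.inf s') ∧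
          ∀ n, (s.get n).1 = (s'.get n).1 ∧ Sim (s.get n).2 (s'.get n).2
  | .fin [] _, σ, σ', h, _ => ⟨[], ⟨trivial, h.2⟩, .nil⟩
  | .fin (a :: l) e, σ, σ', h, hσ => by
    obtain ⟨ρ', hρ, hR⟩ := hstep σ σ' a hσ h.1.1
    obtain ⟨l', hl, hs⟩ := Follows.simulate hstep (u := .fin l e) ⟨h.1.2, h.2⟩ hρ
    exact ⟨(a.1, ρ') :: l', ⟨⟨hR, hl.1⟩, hl.2⟩, .cons ⟨rfl, hρ⟩ hs⟩
  | .inf s, σ, σ', h, hσ => by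
    -- With the implication under the existential, `choose` gives a successor function defined on
    -- all states; at unrelated states the default `x` is never used.
    have key : ∀ n x, ∃ y, Sim (stateAt σ s n) x →
        Sim (s.get n).2 y ∧ (x, y) ∈ R' (s.get n).1 := by
      intro n x
      by_cases hx : Sim (stateAt σ s n) x
      · obtain ⟨y, hy⟩ := hstep _ _ _ hx (h n)
        exact ⟨y, fun _ => hy⟩
      · exact ⟨x, fun h => absurd h hx⟩
    choose f hf using key
    let g : ℕ → S := fun n => Nat.rec σ' f n
    have hg : ∀ n, Sim (stateAt σ s n) (g n) := by
      intro n
      induction n with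
      | zero => exact hσ
      | succ n ih => exact (hf n _ ih).1
    let s' : Stream' (Step S) := fun n => ((s.get n).1, g (n + 1))
    have hs' : ∀ n, stateAt σ' s' n = g n := by
      rintro (_ | n) <;> rfl
    refine ⟨s', fun n => ?_, fun n => ⟨rfl, hg (n + 1)⟩⟩
    rw [hs']
    exact (hf n _ (hg n)).2

/-! ### Traces of compositions -/

/-- A command without aborted traces. -/
def AbortFree (c : Cmd S) : Prop := ∀ σ l, (⟨σ, .fin l .aborted⟩ : Trace S) ∉ c.traces

theorem abortFree_followCmd (R : Kind → Set (S × S)) : AbortFree (followCmd R) :=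
  fun _ _ h => h.2 rfl

theorem traces_wconj {c d : Cmd S} (hc : AbortFree c) (hd : AbortFree d) :
    (c ⋒ d).traces = c.traces ∩ d.traces := by
  refine Set.Subset.antisymm ?_ Set.subset_union_left
  rintro t (h | ⟨l, q, -, ⟨h, -⟩ | ⟨-, h⟩⟩)
  · exact h
  · exact absurd h (hc _ _)
  · exact absurd h (hd _ _)

theorem AbortFree.wconj {c d : Cmd S} (hc : AbortFree c) (hd : AbortFree d) :
    AbortFree (c ⋒ d) := by
  intro σ l h
  rw [traces_wconj hc hd] at h
  exact hc _ _ h.1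

/-- The first alternative is needed because an infeasible test still has the incomplete trace
without transitions, also from states outside `p`. -/
theorem mem_test_seq {p : Set S} {c : Cmd S} {t : Trace S} :
    t ∈ (test p ⨾ c).traces ↔ t.run = .fin [] .incomplete ∨ t.init ∈ p ∧ t ∈ c.traces := by
  obtain ⟨σ, u⟩ := t
  constructor
  · rintro ((⟨h | h, hn⟩ | ⟨l, q, -, h | h⟩) | ⟨l, q, hu, h | h, hd⟩)
    · exact Or.inl h
    · exact absurd h.2 (hn _)
    · simp [idleTraces] at h
    · simp at h
    · simp [idleTraces] at h
    · obtain ⟨h, hl⟩ := h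
      cases hl
      dsimp only at hu
      rw [hu, Run.after_nil]
      exact Or.inr ⟨h, hd⟩
  · rintro (h | ⟨hp, h⟩)
    · dsimp only at h
      subst h
      exact Cmd.empty_mem _ _
    · exact Or.inr ⟨[], u, (Run.after_nil u).symm, Or.inr ⟨hp, rfl⟩, h⟩

theorem AbortFree.test_seq {p : Set S} {c : Cmd S} (hc : AbortFree c) :
    AbortFree (test p ⨾ c) := by
  intro σ l h
  rcases mem_test_seq.1 h with h | h
  · simp at h
  · exact hc _ _ h.2

/-- The traces of a command are traces of the command under any assertion. -/
theorem mem_assertion_seq {p : Set S} {c : Cmd S} {t : Trace S} (h : t ∈ c.traces) :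
    t ∈ (assertion p ⨾ c).traces :=
  Or.inr ⟨[], t.run, (Run.after_nil t.run).symm, Or.inl (Or.inr ⟨trivial, rfl⟩), h⟩

end Follows

/-! ### Values for the hidden variable -/

section Hide

variable {Var Val : Type*}

/-- The hidden variable can be given values that establish `I` along a run whose program
transitions preserve `∃v. I`, without being changed by the environment. -/
theorem exists_eqOff_follows {v : Var} {V : Set Var} {I : Set (Var → Val)} (hv : v ∉ V)
    (hI : idOn (insert v V) ⊆ impR (preR I) (postR I)) {σ σ' : Var → Val} (hσ : EqOff v σ σ')
    (hσI : σ' ∈ I) {u : Run (Var → Val)}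
    (h : Follows (kindRel (impR (preR (hideS v I)) (postR (hideS v I))) (idOn V)) σ u) :
    ∃ u', Run.EqOff v u u' ∧ Follows (kindRel (postR I) (postR I ∩ idOn {v})) σ' u' := by
  classical
  have hsim := Follows.simulate (Sim := fun σ σ' => EqOff v σ σ' ∧ σ' ∈ I)
    (R' := kindRel (postR I) (postR I ∩ idOn {v})) (fun σ σ' a => ?_) h ⟨hσ, hσI⟩
  · cases u with
    | fin l e =>
      obtain ⟨l', hl, hs⟩ := hsim
      exact ⟨.fin l' e, ⟨hs.imp fun _ _ h => ⟨h.1, h.2.1⟩, rfl⟩, hl⟩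
    | inf s =>
      obtain ⟨s', hl, hs⟩ := hsim
      exact ⟨.inf s', fun n => ⟨(hs n).1, (hs n).2.1⟩, hl⟩
  · rintro ⟨hoff, hin⟩ ha
    obtain ⟨_ | _, ρ⟩ := a
    · rcases ha with ha | ⟨ρ', hρ, hoff'⟩
      -- The current hidden state `σ'` itself witnesses that the outer state is in `∃v. I`, so the
      -- guarantee cannot hold vacuously.
      · exact absurd ⟨σ', hin, hoff⟩ ha
      · exact ⟨ρ', ⟨hoff', hρ⟩, hρ⟩
    -- The environment must not change the hidden `v`, so the new hidden state is the outer one with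
    -- the old hidden value of `v`.
    · have hoff' : EqOff v ρ (Function.update ρ v (σ' v)) := fun x hx => by simp [hx]
      have hid : (σ', Function.update ρ v (σ' v)) ∈ idOn (insert v V) := by
        rintro x (rfl | hx)
        · simp
        -- Variables in `V` differ from `v`, so inner and outer states agree on them and the outer
        -- demand carries over.
        · have hxv : x ≠ v := fun h => hv (h ▸ hx)
          change Function.update ρ v (σ' v) x = σ' x
          rw [← hoff' x hxv, ← hoff x hxv]
          exact ha x hx
      have hρ : Function.update ρ v (σ' v) ∈ I := (hI hid).resolve_left fun h => h hin
      exact ⟨_, ⟨hoff', hρ⟩, hρ, fun x hx => hid x (Or.inl hx)⟩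

end Hide

end AczelAlgebra

theorem mainTheorem2 {Var Val : Type*} (v w : Var) (I : Set (Var → Val))
    (hvw : v ≠ w) (hI : idOn {w, v} ⊆ impR (preR I) (postR I)) :
    localBlock v (test I ⨾ invariant I) ⋒ demand (idOn {w}) ⪰
      test (hideS v I) ⨾ guar (impR (preR (hideS v I)) (postR (hideS v I))) ⋒
        demand (idOn {w}) ⋒ guar (idOn {v}) := by
  simp only [Refines, localBlock, invariant, guar, demand, promise, anystep, iter_pstep_sup_estep]
  have hfree := abortFree_followCmd (S := Var → Val)
  rintro t ht
  rw [traces_wconj ((hfree _).test_seq.wconj (hfree _)) (hfree _),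
    traces_wconj (hfree _).test_seq (hfree _)] at ht
  obtain ⟨⟨ht, hw⟩, hv⟩ := ht
  -- Membership through the common traces suffices, so the aborting alternatives of weak conjunction
  -- on the left are never used.
  refine Or.inl ⟨Or.inl ⟨hv, ?_⟩, hw⟩
  obtain ⟨σ, u⟩ := t
  rcases mem_test_seq.1 ht with h | ⟨⟨σ', hσI, hσ⟩, hg⟩
  · dsimp only at h
    subst h
    exact Cmd.empty_mem _ _
  · obtain ⟨u', hu, hf⟩ := exists_eqOff_follows (V := {w}) (u := u) hvw
      (by rwa [Set.pair_comm] at hI) hσ hσI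
      -- The guarantee supplies the program transitions and the demand on `w` the environment ones.
      ((Follows.inter hg hw).mono fun k => by
        cases k
        · exact Set.inter_subset_left
        · exact Set.inter_subset_right)
    -- The same hidden run meets both inner constraints: its frozen `v` gives the demand, and its
    -- states in `I` give the promise.
    refine ⟨⟨σ', u'⟩, Or.inl ⟨hf.mono fun k => ?_, mem_test_seq.2 (Or.inr ⟨hσI,
      mem_assertion_seq (hf.mono fun k => ?_)⟩)⟩, hσ, hu⟩
    · cases k
      · exact Set.subset_univ _
      · exact Set.inter_subset_right
    · cases k
      · exact subset_rfl
      · exact Set.inter_subset_left
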